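/- Let $\mathrm{Homeo}^+(\mathbb{R})$ be the group of all orientation-preserving (i.e. strictly increasing) homeomorphisms of $\mathbb{R}$ under composition, equipped with the compact-open topology (equivalently, on this group, the topology of pointwise convergence). Then $\mathrm{Homeo}^+(\mathbb{R})$ has no non-trivial continuous unitary representations: if $\mathcal{H}$ is a complex Hilbert space (of any dimension) and $\pi \colon \mathrm{Homeo}^+(\mathbb{R}) \to U(\mathcal{H})$ is a homomorphism to the unitary group of $\mathcal{H}$ such that $g \mapsto \pi(g)\xi$ is continuous for every $\xi \in \mathcal{H}$, then $\pi(g)\xi = \xi$ for all $g \in \mathrm{Homeo}^+(\mathbb{R})$ and $\xi \in \mathcal{H}$. -/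

import Mathlib

open Topology

/-- `Homeo⁺(ℝ)`: the group, under composition, of all orientation-preserving (that is, strictly
increasing) homeomorphisms of the real line. -/
def HomeoPlusReal : Subgroup (ℝ ≃ₜ ℝ) where
  carrier := {f | StrictMono f}
  mul_mem' {f g} hf hg := by
    intro x y hxy
    exact hf (hg hxy)
  one_mem' := by
    intro x y hxy
    exact hxy
  inv_mem' {f} hf := by
    intro x y hxy
    refine hf.lt_iff_lt.1 ?_
    simpa using hxy

namespace HomeoPlusReal

/-- An element of `Homeo⁺(ℝ)` as a continuous map `ℝ → ℝ`. -/
def toContinuousMap (g : HomeoPlusReal) : C(ℝ, ℝ) :=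
  ⟨(g : ℝ ≃ₜ ℝ), (g : ℝ ≃ₜ ℝ).continuous⟩

/-- `Homeo⁺(ℝ)` carries the compact-open topology. -/
instance : TopologicalSpace HomeoPlusReal :=
  TopologicalSpace.induced toContinuousMap ContinuousMap.compactOpen

theorem continuous_toContinuousMap : Continuous toContinuousMap :=
  continuous_induced_dom

theorem continuous_eval_const (x : ℝ) :
    Continuous fun g : HomeoPlusReal => (g : ℝ ≃ₜ ℝ) x :=
  continuous_toContinuousMap.eval_const x

/-- A map into `Homeo⁺(ℝ)` is continuous as soon as it is continuous at every point of `ℝ`: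
the compact-open topology is the topology of pointwise convergence. -/
theorem continuous_iff_eval {X : Type*} [TopologicalSpace X] {F : X → HomeoPlusReal} :
    Continuous F ↔ ∀ x : ℝ, Continuous fun p => (F p : ℝ ≃ₜ ℝ) x := by
  refine ⟨fun h x => (continuous_eval_const x).comp h, fun h => ?_⟩
  refine continuous_induced_rng.2 (ContinuousMap.continuous_of_continuous_uncurry _ ?_)
  refine continuous_iff_continuousAt.2 ?_
  rintro ⟨p, x⟩
  have hmono : ∀ q : X, Monotone (F q : ℝ ≃ₜ ℝ) := fun q => StrictMono.monotone (F q).2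
  have hc : ContinuousAt (F p : ℝ ≃ₜ ℝ) x := (F p : ℝ ≃ₜ ℝ).continuous.continuousAt
  refine tendsto_order.2 ⟨fun c hcx => ?_, fun d hdx => ?_⟩
  · obtain ⟨a, hca, hax⟩ :=
      (((hc.eventually (lt_mem_nhds hcx)).filter_mono nhdsWithin_le_nhds).and
        (self_mem_nhdsWithin : Set.Iio x ∈ 𝓝[<] x)).exists
    have h1 : ∀ᶠ q in 𝓝 p, c < (F q : ℝ ≃ₜ ℝ) a :=
      (h a).continuousAt.eventually (lt_mem_nhds hca)
    have h2 : ∀ᶠ y in 𝓝 x, a < y := lt_mem_nhds hax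
    rw [nhds_prod_eq]
    filter_upwards [h1.prod_mk h2] with z hz
    exact lt_of_lt_of_le hz.1 (hmono z.1 hz.2.le)
  · obtain ⟨b, hbd, hxb⟩ :=
      (((hc.eventually (gt_mem_nhds hdx)).filter_mono nhdsWithin_le_nhds).and
        (self_mem_nhdsWithin : Set.Ioi x ∈ 𝓝[>] x)).exists
    have h1 : ∀ᶠ q in 𝓝 p, (F q : ℝ ≃ₜ ℝ) b < d :=
      (h b).continuousAt.eventually (gt_mem_nhds hbd)
    have h2 : ∀ᶠ y in 𝓝 x, y < b := gt_mem_nhds hxb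
    rw [nhds_prod_eq]
    filter_upwards [h1.prod_mk h2] with z hz
    exact lt_of_le_of_lt (hmono z.1 hz.2.le) hz.1

/-- The compact-open topology on `Homeo⁺(ℝ)` is the topology of pointwise convergence. -/
theorem isInducing_coe : IsInducing fun (g : HomeoPlusReal) (x : ℝ) => (g : ℝ ≃ₜ ℝ) x := by
  refine ⟨le_antisymm (continuous_pi continuous_eval_const).le_induced ?_⟩
  refine continuous_id_iff_le.1 ((@continuous_iff_eval _ (TopologicalSpace.induced _ _) id).2 ?_)
  exact fun x => @Continuous.comp _ _ _ (TopologicalSpace.induced _ _) _ _ _ _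
    (continuous_apply x) continuous_induced_dom

instance : IsTopologicalGroup HomeoPlusReal where
  continuous_mul := by
    refine continuous_induced_rng.2 ?_
    exact ContinuousMap.continuous_comp'.comp
      ((continuous_toContinuousMap.comp continuous_snd).prodMk
        (continuous_toContinuousMap.comp continuous_fst))
  continuous_inv := by
    refine continuous_iff_eval.2 fun y => ?_
    have key : ∀ (g : HomeoPlusReal) (a : ℝ),
        (a < ((g⁻¹ : HomeoPlusReal) : ℝ ≃ₜ ℝ) y ↔ (g : ℝ ≃ₜ ℝ) a < y) ∧
        (((g⁻¹ : HomeoPlusReal) : ℝ ≃ₜ ℝ) y < a ↔ y < (g : ℝ ≃ₜ ℝ) a) := by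
      intro g a
      have hg : StrictMono (g : ℝ ≃ₜ ℝ) := g.2
      have e : (g : ℝ ≃ₜ ℝ) (((g⁻¹ : HomeoPlusReal) : ℝ ≃ₜ ℝ) y) = y := by simp
      constructor
      · rw [← hg.lt_iff_lt, e]
      · rw [← hg.lt_iff_lt, e]
    refine continuous_iff_continuousAt.2 fun g => tendsto_order.2 ⟨fun a ha => ?_, fun a ha => ?_⟩
    · filter_upwards [(continuous_eval_const a).continuousAt.eventually
        (gt_mem_nhds ((key g a).1.1 ha))] with q hq
      exact (key q a).1.2 hq
    · filter_upwards [(continuous_eval_const a).continuousAt.eventually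
        (lt_mem_nhds ((key g a).2.1 ha))] with q hq
      exact (key q a).2.2 hq

end HomeoPlusReal

/-- A unitary representation of a topological group `G` on a complex Hilbert space `H`: a
homomorphism from `G` to the unitary group of `H` that is strongly continuous, i.e. all of whose
orbit maps `g ↦ π(g) ξ` are continuous. -/
structure UnitaryRep (G : Type*) [Group G] [TopologicalSpace G]
    (H : Type*) [NormedAddCommGroup H] [InnerProductSpace ℂ H] [CompleteSpace H] where
  /-- The underlying homomorphism to the unitary group. -/
  toHom : G →* unitary (H →L[ℂ] H)
  /-- Strong continuity. -/
  continuous_orbit : ∀ ξ : H, Continuous fun g : G => (toHom g : H →L[ℂ] H) ξ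

/-- A representation is trivial if every group element acts as the identity. -/
def UnitaryRep.IsTrivial {G : Type*} [Group G] [TopologicalSpace G]
    {H : Type*} [NormedAddCommGroup H] [InnerProductSpace ℂ H] [CompleteSpace H]
    (π : UnitaryRep G H) : Prop :=
  ∀ (g : G) (ξ : H), (π.toHom g : H →L[ℂ] H) ξ = ξ

/-! By continuity, the pointwise stabilizer of some finite set `F` moves a given vector `ξ` only
slightly, so `exists_fixed_of_dist_le` yields a vector `v` near `ξ` that this stabilizer fixes. It
remains to see that such a `v` is invariant under the whole group
(`toHom_apply_eq_of_fixed_by_pointwiseStabilizer`).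

The coefficient `g ↦ ⟪π(g)v, v⟫` is constant on double cosets of the stabilizer, and `interleaving
F` lies in a single one. The identity is a limit of that set, so the constant is `‖v‖²`, which
forces `π(g)v = v` there. The stabilizer of `v` thus contains a nonempty open set; it is an open
subgroup of a connected group, hence everything. -/

/-- If a group of linear isometries of a real Hilbert space moves `ξ` by at most `δ`, then it has a
fixed vector at distance at most `δ` from `ξ`. -/
theorem exists_fixed_vector_of_dist_orbit_le {G E : Type*} [Group G] [NormedAddCommGroup E]
    [InnerProductSpace ℝ E] [CompleteSpace E] (ρ : G →* (E →ₗ[ℝ] E))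
    (hρ : ∀ g v, ‖ρ g v‖ = ‖v‖) (ξ : E) (δ : ℝ) (hξ : ∀ g, ‖ρ g ξ - ξ‖ ≤ δ) :
    ∃ v, ‖v - ξ‖ ≤ δ ∧ ∀ g, ρ g v = v := by
  -- The group permutes these balls and preserves the norm, so the unique point of least norm in `K`
  -- is fixed.
  set K : Set E := ⋂ g : G, Metric.closedBall (ρ g ξ) δ with hK
  have hmem : ∀ v, v ∈ K ↔ ∀ g, ‖v - ρ g ξ‖ ≤ δ := fun v => by
    simp [hK, dist_eq_norm]
  have hne : K.Nonempty := ⟨ξ, (hmem ξ).2 fun g => by rw [norm_sub_rev]; exact hξ g⟩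
  have hconv : Convex ℝ K := convex_iInter fun g => convex_closedBall _ _
  have hcl : IsClosed K := isClosed_iInter fun g => Metric.isClosed_closedBall
  obtain ⟨v, hvK, hv⟩ := exists_norm_eq_iInf_of_complete_convex hne hcl.isComplete hconv 0
  have hmin : ∀ w ∈ K, ‖v‖ ≤ ‖w‖ := fun w hw => by
    rw [zero_sub, norm_neg] at hv
    rw [hv]
    have := ciInf_le (f := fun w : K => ‖0 - (w : E)‖) ⟨0, by
      rintro _ ⟨w, rfl⟩
      exact norm_nonneg _⟩ ⟨w, hw⟩
    simpa using this
  have hinv : ∀ g, ρ g v ∈ K := fun g => (hmem _).2 fun h => by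
    have h1 : ρ h ξ = ρ g (ρ (g⁻¹ * h) ξ) := by
      rw [← Module.End.mul_apply, ← map_mul, mul_inv_cancel_left]
    rw [h1, ← map_sub, hρ]
    exact (hmem v).1 hvK _
  refine ⟨v, by simpa using (hmem v).1 hvK 1, fun g => ?_⟩
  by_contra hne'
  have h2 : (1 / 2 : ℝ) • (ρ g v + v) ∈ K := by
    rw [smul_add]
    exact hconv (hinv g) hvK (by norm_num) (by norm_num) (by norm_num)
  -- Strict convexity: the midpoint of two distinct vectors of equal norm is shorter.
  have h3 := (norm_midpoint_lt_iff (hρ g v)).2 hne'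
  rw [hρ] at h3
  exact absurd (hmin _ h2) (not_le.2 h3)

/-! ### Constructing increasing homeomorphisms -/

namespace HomeoPlusReal

theorem strictMono_coe (g : HomeoPlusReal) : StrictMono (g : ℝ ≃ₜ ℝ) := g.2

theorem mul_apply (g h : HomeoPlusReal) (x : ℝ) :
    ((g * h : HomeoPlusReal) : ℝ ≃ₜ ℝ) x = (g : ℝ ≃ₜ ℝ) ((h : ℝ ≃ₜ ℝ) x) := rfl

theorem one_apply (x : ℝ) : ((1 : HomeoPlusReal) : ℝ ≃ₜ ℝ) x = x := rfl

theorem inv_apply_apply (g : HomeoPlusReal) (x : ℝ) :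
    ((g⁻¹ : HomeoPlusReal) : ℝ ≃ₜ ℝ) ((g : ℝ ≃ₜ ℝ) x) = x := by
  rw [← mul_apply, inv_mul_cancel, one_apply]

/-- A strictly increasing surjection of `ℝ` as an element of `Homeo⁺(ℝ)`. -/
noncomputable def ofStrictMono (f : ℝ → ℝ) (hf : StrictMono f) (hs : Function.Surjective f) :
    HomeoPlusReal :=
  ⟨(hf.orderIsoOfSurjective f hs).toHomeomorph, hf⟩

theorem ofStrictMono_apply (f : ℝ → ℝ) (hf : StrictMono f) (hs : Function.Surjective f) (x : ℝ) :
    (ofStrictMono f hf hs : ℝ ≃ₜ ℝ) x = f x := rfl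

/-- Some element of `Homeo⁺(ℝ)` fixes `(-∞, b]` pointwise and moves `c > b` to `d > b`. -/
theorem exists_fix_Iic_apply_eq {b c d : ℝ} (hc : b < c) (hd : b < d) :
    ∃ k : HomeoPlusReal, (∀ x ≤ b, (k : ℝ ≃ₜ ℝ) x = x) ∧ (k : ℝ ≃ₜ ℝ) c = d := by
  set r : ℝ := (d - b) / (c - b) with hr
  have hr0 : 0 < r := div_pos (sub_pos.2 hd) (sub_pos.2 hc)
  have hmono : StrictMono fun x : ℝ => if x ≤ b then x else b + r * (x - b) := by
    intro x y hxy
    dsimp only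
    split_ifs with h1 h2 h2
    · exact hxy
    · have := mul_pos hr0 (sub_pos.2 (not_le.1 h2))
      linarith
    · linarith
    · have := mul_lt_mul_of_pos_left hxy hr0
      linarith
  refine ⟨ofStrictMono _ hmono fun y => ?_, fun x hx => ?_, ?_⟩
  · by_cases hy : y ≤ b
    · exact ⟨y, if_pos hy⟩
    · refine ⟨b + (y - b) / r, ?_⟩
      have := div_pos (sub_pos.2 (not_le.1 hy)) hr0
      rw [if_neg (by linarith)]
      field_simp
      ring
  · exact (ofStrictMono_apply _ _ _ x).trans (if_pos hx)
  · refine (ofStrictMono_apply _ _ _ c).trans ((if_neg (not_le.2 hc)).trans ?_)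
    rw [hr, div_mul_cancel₀ _ (sub_pos.2 hc).ne']
    ring

/-- The translation `x ↦ x + t`. -/
noncomputable def translation (t : ℝ) : HomeoPlusReal :=
  ofStrictMono (fun x => x + t) add_left_strictMono (fun y => ⟨y - t, sub_add_cancel y t⟩)

theorem translation_apply (t x : ℝ) : (translation t : ℝ ≃ₜ ℝ) x = x + t := rfl

/-- A strictly increasing function on a finite set extends to an element of `Homeo⁺(ℝ)`. -/
theorem exists_eqOn_of_strictMonoOn (s : Finset ℝ) (f : ℝ → ℝ) (hf : StrictMonoOn f s) :
    ∃ k : HomeoPlusReal, ∀ x ∈ s, (k : ℝ ≃ₜ ℝ) x = f x := by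
  induction s using Finset.induction_on_max with
  | empty => exact ⟨1, by simp⟩
  | insert a s ha ih =>
    obtain ⟨k, hk⟩ := ih (hf.mono (by simp))
    rcases s.eq_empty_or_nonempty with rfl | hs
    · exact ⟨translation (f a - a), by simp [translation_apply]⟩
    · set m := s.max' hs
      have hm : m ∈ s := s.max'_mem hs
      have h1 : f m < (k : ℝ ≃ₜ ℝ) a := by
        rw [← hk m hm]
        exact strictMono_coe k (ha m hm)
      have h2 : f m < f a := hf (by simp [hm]) (by simp) (ha m hm)
      -- The correction at the new maximum `a` fixes everything up to `f m`, so the values already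
      -- matched on `s` survive.
      obtain ⟨k', hk', hk'a⟩ := exists_fix_Iic_apply_eq h1 h2
      refine ⟨k' * k, fun x hx => ?_⟩
      rw [mul_apply]
      rcases Finset.mem_insert.1 hx with rfl | hx
      · exact hk'a
      · rw [hk x hx]
        refine hk' _ (hf.monotoneOn (by simp [hx]) (by simp [hm]) (s.le_max' x hx))

/-! ### Connectedness -/

/-- The affine path from the identity to `g`. -/
noncomputable def affinePath (g : HomeoPlusReal) (t : unitInterval) : HomeoPlusReal :=
  have hmono : StrictMono fun x : ℝ => (1 - (t : ℝ)) * x + t * (g : ℝ ≃ₜ ℝ) x := by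
    intro x y hxy
    have h1 := strictMono_coe g hxy
    have h2 := t.2.1
    have h3 := t.2.2
    dsimp only
    rcases h2.eq_or_lt with h0 | h0
    · rw [← h0]; linarith
    · have := mul_lt_mul_of_pos_left h1 h0
      have := mul_le_mul_of_nonneg_left hxy.le (sub_nonneg.2 h3)
      linarith
  ofStrictMono _ hmono <| by
    intro y
    set x := ((g⁻¹ : HomeoPlusReal) : ℝ ≃ₜ ℝ) y
    have hx : (g : ℝ ≃ₜ ℝ) x = y := by
      rw [← mul_apply, mul_inv_cancel, one_apply]
    have h2 := t.2.1
    have h3 := t.2.2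
    have hc : Continuous fun x : ℝ => (1 - (t : ℝ)) * x + t * (g : ℝ ≃ₜ ℝ) x := by fun_prop
    have hlo := (strictMono_coe g).monotone (min_le_left x y)
    have hhi := (strictMono_coe g).monotone (le_max_left x y)
    rw [hx] at hlo hhi
    -- The path averages `id` and `g`, which take the value `y` at `y` and at `x`; hence it is at
    -- most `y` at `min x y` and at least `y` at `max x y`.
    refine mem_range_of_exists_le_of_exists_ge hc ⟨min x y, ?_⟩ ⟨max x y, ?_⟩
    · nlinarith [min_le_right x y, mul_nonneg h2 (sub_nonneg.2 hlo),
        mul_nonneg (sub_nonneg.2 h3) (sub_nonneg.2 (min_le_right x y))]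
    · nlinarith [le_max_right x y, mul_nonneg h2 (sub_nonneg.2 hhi),
        mul_nonneg (sub_nonneg.2 h3) (sub_nonneg.2 (le_max_right x y))]

theorem affinePath_apply (g : HomeoPlusReal) (t : unitInterval) (x : ℝ) :
    (affinePath g t : ℝ ≃ₜ ℝ) x = (1 - (t : ℝ)) * x + t * (g : ℝ ≃ₜ ℝ) x := rfl

theorem continuous_affinePath (g : HomeoPlusReal) : Continuous (affinePath g) :=
  continuous_iff_eval.2 fun x => by
    simp only [affinePath_apply]
    fun_prop

theorem affinePath_zero (g : HomeoPlusReal) : affinePath g 0 = 1 :=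
  Subtype.ext (Homeomorph.ext fun x => by rw [affinePath_apply, one_apply]; simp)

theorem affinePath_one (g : HomeoPlusReal) : affinePath g 1 = g :=
  Subtype.ext (Homeomorph.ext fun x => by rw [affinePath_apply]; simp)

instance : PreconnectedSpace HomeoPlusReal where
  isPreconnected_univ := isPreconnected_of_forall 1 fun g _ =>
    ⟨Set.range (affinePath g), Set.subset_univ _, ⟨0, affinePath_zero g⟩, ⟨1, affinePath_one g⟩,
      isPreconnected_range (continuous_affinePath g)⟩

/-! ### Stabilizers of finite sets and interleaving -/

/-- The pointwise stabilizer of a set of reals. -/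
def pointwiseStabilizer (F : Set ℝ) : Subgroup HomeoPlusReal where
  carrier := {g | ∀ x ∈ F, (g : ℝ ≃ₜ ℝ) x = x}
  mul_mem' {g h} hg hh x hx := by rw [mul_apply, hh x hx, hg x hx]
  one_mem' _ _ := rfl
  inv_mem' {g} hg x hx := by
    have := inv_apply_apply g x
    rwa [hg x hx] at this

/-- Every neighborhood of the identity contains the pointwise stabilizer of a finite set. -/
theorem exists_pointwiseStabilizer_subset {U : Set HomeoPlusReal} (hU : U ∈ 𝓝 1) :
    ∃ F : Finset ℝ, (pointwiseStabilizer F : Set HomeoPlusReal) ⊆ U := by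
  rw [isInducing_coe.nhds_eq_comap, Filter.mem_comap] at hU
  obtain ⟨V, hV, hVU⟩ := hU
  rw [nhds_pi, Filter.mem_pi'] at hV
  obtain ⟨F, t, ht, htV⟩ := hV
  refine ⟨F, fun g hg => hVU (htV fun x hx => ?_)⟩
  have h1 : (g : ℝ ≃ₜ ℝ) x = x := hg x hx
  dsimp only
  rw [h1]
  exact mem_of_mem_nhds (ht x)

/-- The elements moving every point of `F` to the right, but not as far as the next point of
`F`. -/
def interleaving (F : Finset ℝ) : Set HomeoPlusReal :=
  {g | ∀ x ∈ F, x < (g : ℝ ≃ₜ ℝ) x ∧ ∀ y ∈ F, x < y → (g : ℝ ≃ₜ ℝ) x < y}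

theorem isOpen_interleaving (F : Finset ℝ) : IsOpen (interleaving F) := by
  have h : interleaving F = ⋂ x ∈ F, ({g : HomeoPlusReal | x < (g : ℝ ≃ₜ ℝ) x} ∩
      ⋂ y ∈ F, {g : HomeoPlusReal | x < y → (g : ℝ ≃ₜ ℝ) x < y}) := by
    ext g
    simp [interleaving]
  rw [h]
  refine isOpen_biInter_finset fun x _ => (isOpen_lt continuous_const
    (continuous_eval_const x)).inter (isOpen_biInter_finset fun y _ => ?_)
  by_cases hxy : x < y
  · simpa [hxy] using isOpen_lt (continuous_eval_const x) continuous_const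
  · simp [hxy]

/-- Translations by `t > 0` smaller than every gap of `F` interleave, and they tend to the identity
as `t → 0`. -/
theorem one_mem_closure_interleaving (F : Finset ℝ) : 1 ∈ closure (interleaving F) := by
  have hcont : Continuous translation := continuous_iff_eval.2 fun x => by
    simp only [translation_apply]
    fun_prop
  have h0 : translation 0 = 1 := Subtype.ext (Homeomorph.ext fun x => by rw [translation_apply, one_apply, add_zero])
  have hlim : Filter.Tendsto translation (𝓝[>] 0) (𝓝 1) := by
    rw [← h0]
    exact hcont.continuousAt.mono_left nhdsWithin_le_nhds
  refine mem_closure_of_tendsto hlim ?_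
  have hgap : ∀ᶠ t : ℝ in 𝓝[>] 0, ∀ x ∈ F, ∀ y ∈ F, x < y → x + t < y := by
    refine (Filter.eventually_all_finset F).2 fun x _ =>
      (Filter.eventually_all_finset F).2 fun y _ => ?_
    by_cases hxy : x < y
    · filter_upwards [nhdsWithin_le_nhds (gt_mem_nhds (sub_pos.2 hxy))] with t ht _
      linarith
    · exact Filter.Eventually.of_forall fun t h => absurd h hxy
  filter_upwards [hgap, self_mem_nhdsWithin] with t ht (ht0 : 0 < t)
  intro x hx
  rw [translation_apply]
  exact ⟨by linarith, fun y hy hxy => ht x hx y hy hxy⟩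

/-- The pointwise stabilizer of `F` acts transitively on the positions of `F` interleaved
with `F`. -/
theorem exists_fix_apply_eq_of_mem_interleaving {F : Finset ℝ} {g h : HomeoPlusReal}
    (hg : g ∈ interleaving F) (hh : h ∈ interleaving F) :
    ∃ k ∈ pointwiseStabilizer F, ∀ x ∈ F,
      (k : ℝ ≃ₜ ℝ) ((g : ℝ ≃ₜ ℝ) x) = (h : ℝ ≃ₜ ℝ) x := by
  classical
  have hnot : ∀ x ∈ F, (g : ℝ ≃ₜ ℝ) x ∉ F := fun x hx hgx =>
    lt_irrefl _ ((hg x hx).2 _ hgx (hg x hx).1)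
  -- The identity on `F` and `h ∘ g⁻¹` on `g(F)`; the two prescriptions do not clash because `g(F)`
  -- misses `F`. Interleaving makes the order of `F ∪ g(F)` agree with that of `F ∪ h(F)`.
  set f : ℝ → ℝ := fun x =>
    if x ∈ F then x else (h : ℝ ≃ₜ ℝ) (((g⁻¹ : HomeoPlusReal) : ℝ ≃ₜ ℝ) x) with hf
  have hf1 : ∀ x ∈ F, f x = x := fun x hx => if_pos hx
  have hf2 : ∀ x ∈ F, f ((g : ℝ ≃ₜ ℝ) x) = (h : ℝ ≃ₜ ℝ) x := fun x hx => by
    simp only [hf]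
    rw [if_neg (hnot x hx), inv_apply_apply]
  have hmono : StrictMonoOn f ((F ∪ F.image (g : ℝ ≃ₜ ℝ) : Finset ℝ) : Set ℝ) := by
    intro a ha b hb hab
    rw [Finset.mem_coe, Finset.mem_union, Finset.mem_image] at ha hb
    rcases ha with ha | ⟨x, hx, rfl⟩ <;> rcases hb with hb | ⟨y, hy, rfl⟩
    · rwa [hf1 a ha, hf1 b hb]
    · rw [hf1 a ha, hf2 y hy]
      have : a ≤ y := not_lt.1 fun h' => lt_asymm hab ((hg y hy).2 a ha h')
      exact this.trans_lt (hh y hy).1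
    · rw [hf2 x hx, hf1 b hb]
      exact (hh x hx).2 b hb ((hg x hx).1.trans hab)
    · rw [hf2 x hx, hf2 y hy]
      exact strictMono_coe h ((strictMono_coe g).lt_iff_lt.1 hab)
  obtain ⟨k, hk⟩ := exists_eqOn_of_strictMonoOn _ f hmono
  refine ⟨k, fun x hx => ?_, fun x hx => ?_⟩
  · have hx' : x ∈ F := hx
    rw [hk x (Finset.mem_union_left _ hx'), hf1 x hx']
  · rw [hk _ (Finset.mem_union_right _ (Finset.mem_image_of_mem _ hx)), hf2 x hx]

end HomeoPlusReal

/-! ### Fixed and invariant vectors of unitary representations -/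

namespace UnitaryRep

variable {G : Type*} [Group G] [TopologicalSpace G]
  {H : Type*} [NormedAddCommGroup H] [InnerProductSpace ℂ H] [CompleteSpace H]

theorem toHom_mul_apply (π : UnitaryRep G H) (g h : G) (ξ : H) :
    (π.toHom (g * h) : H →L[ℂ] H) ξ = (π.toHom g : H →L[ℂ] H) ((π.toHom h : H →L[ℂ] H) ξ) := by
  rw [map_mul]
  rfl

theorem toHom_one_apply (π : UnitaryRep G H) (ξ : H) : (π.toHom 1 : H →L[ℂ] H) ξ = ξ := by
  rw [map_one]
  rfl

theorem inner_toHom_toHom (π : UnitaryRep G H) (g : G) (ξ η : H) :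
    inner ℂ ((π.toHom g : H →L[ℂ] H) ξ) ((π.toHom g : H →L[ℂ] H) η) = inner ℂ ξ η :=
  ContinuousLinearMap.inner_map_map_of_mem_unitary (π.toHom g).2 ξ η

theorem norm_toHom (π : UnitaryRep G H) (g : G) (ξ : H) :
    ‖(π.toHom g : H →L[ℂ] H) ξ‖ = ‖ξ‖ :=
  ContinuousLinearMap.norm_map_of_mem_unitary (π.toHom g).2 ξ

/-- The subgroup fixing a given vector. -/
def vectorStabilizer (π : UnitaryRep G H) (v : H) : Subgroup G where
  carrier := {g | (π.toHom g : H →L[ℂ] H) v = v}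
  mul_mem' {g h} (hg : _ = _) (hh : _ = _) := by
    change _ = _
    rw [toHom_mul_apply, hh, hg]
  one_mem' := toHom_one_apply π v
  inv_mem' {g} (hg : _ = _) := by
    change _ = _
    conv_lhs => rw [← hg]
    rw [← toHom_mul_apply, inv_mul_cancel, toHom_one_apply]

/-- A vector almost fixed by a subgroup is close to a vector fixed by it. -/
theorem exists_fixed_of_dist_le (π : UnitaryRep G H) (S : Subgroup G) (ξ : H) (δ : ℝ)
    (hξ : ∀ g ∈ S, ‖(π.toHom g : H →L[ℂ] H) ξ - ξ‖ ≤ δ) :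
    ∃ v, ‖v - ξ‖ ≤ δ ∧ ∀ g ∈ S, (π.toHom g : H →L[ℂ] H) v = v := by
  let : InnerProductSpace ℝ H := InnerProductSpace.rclikeToReal ℂ H
  let ρ : S →* (H →ₗ[ℝ] H) :=
    { toFun := fun g => ((π.toHom g : H →L[ℂ] H) : H →ₗ[ℂ] H).restrictScalars ℝ
      map_one' := LinearMap.ext fun v => toHom_one_apply π v
      map_mul' := fun g h => LinearMap.ext fun v => toHom_mul_apply π g h v }
  obtain ⟨v, hv, hfix⟩ := exists_fixed_vector_of_dist_orbit_le ρ
    (fun g v => norm_toHom π g v) ξ δ (fun g => hξ g g.2)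
  exact ⟨v, hv, fun g hg => hfix ⟨g, hg⟩⟩

open HomeoPlusReal in
/-- A vector fixed by the pointwise stabilizer of a finite set is invariant. -/
theorem toHom_apply_eq_of_fixed_by_pointwiseStabilizer (π : UnitaryRep HomeoPlusReal H)
    (F : Finset ℝ) (v : H)
    (hv : ∀ g ∈ pointwiseStabilizer F, (π.toHom g : H →L[ℂ] H) v = v) (g : HomeoPlusReal) :
    (π.toHom g : H →L[ℂ] H) v = v := by
  have hconst : ∀ g ∈ interleaving F, ∀ h ∈ interleaving F,
      inner ℂ ((π.toHom g : H →L[ℂ] H) v) v = inner ℂ ((π.toHom h : H →L[ℂ] H) v) v := by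
    intro g hg h hh
    obtain ⟨k, hk, hkg⟩ := exists_fix_apply_eq_of_mem_interleaving hg hh
    -- Since `kg` and `h` agree on `F`, they differ by an element of the stabilizer on the right, so
    -- `g` and `h` share a double coset.
    have h1 : (π.toHom (h⁻¹ * (k * g)) : H →L[ℂ] H) v = v := hv _ fun x hx => by
      rw [mul_apply, mul_apply, hkg x hx, inv_apply_apply]
    have h2 : (π.toHom k : H →L[ℂ] H) ((π.toHom g : H →L[ℂ] H) v) =
        (π.toHom h : H →L[ℂ] H) v := by
      conv_rhs => rw [← h1]
      rw [← toHom_mul_apply, ← toHom_mul_apply, mul_inv_cancel_left]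
    rw [← inner_toHom_toHom π k, h2, hv k hk]
  have hfix : interleaving F ⊆ vectorStabilizer π v := by
    intro g hg
    have hcl : IsClosed {h : HomeoPlusReal | inner ℂ ((π.toHom h : H →L[ℂ] H) v) v =
        inner ℂ ((π.toHom g : H →L[ℂ] H) v) v} :=
      isClosed_eq ((π.continuous_orbit v).inner continuous_const) continuous_const
    have h1 : inner ℂ ((π.toHom 1 : H →L[ℂ] H) v) v =
        inner ℂ ((π.toHom g : H →L[ℂ] H) v) v :=
      closure_minimal (fun h hh => hconst h hh g hg) hcl (one_mem_closure_interleaving F)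
    rw [toHom_one_apply] at h1
    change _ = _
    -- Equality case of Cauchy–Schwarz: `‖π(g)v - v‖² = 2‖v‖² - 2 Re ⟪π(g)v, v⟫ = 0`.
    rw [← sub_eq_zero, ← norm_eq_zero, ← sq_eq_zero_iff, norm_sub_sq (𝕜 := ℂ), ← h1,
      norm_toHom, inner_self_eq_norm_sq]
    ring
  have hopen : IsOpen (vectorStabilizer π v : Set HomeoPlusReal) := by
    obtain ⟨g, hg⟩ := closure_nonempty_iff.1 ⟨1, one_mem_closure_interleaving F⟩
    exact Subgroup.isOpen_of_mem_nhds _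
      (Filter.mem_of_superset ((isOpen_interleaving F).mem_nhds hg) hfix)
  have huniv : (vectorStabilizer π v : Set HomeoPlusReal) = Set.univ :=
    IsClopen.eq_univ ⟨Subgroup.isClosed_of_isOpen _ hopen, hopen⟩ ⟨1, one_mem _⟩
  exact huniv.ge (Set.mem_univ g)

end UnitaryRep

theorem corollaryc {H : Type*} [NormedAddCommGroup H] [InnerProductSpace ℂ H] [CompleteSpace H]
    (π : UnitaryRep HomeoPlusReal H) : π.IsTrivial := by
  intro g ξ
  refine eq_of_forall_dist_le fun ε hε => ?_
  have hU : {g : HomeoPlusReal | ‖(π.toHom g : H →L[ℂ] H) ξ - ξ‖ < ε / 2} ∈ 𝓝 1 := by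
    have h := (((π.continuous_orbit ξ).sub continuous_const).norm).tendsto' 1 ‖ξ - ξ‖
      (by rw [Pi.sub_apply, π.toHom_one_apply])
    rw [sub_self, norm_zero] at h
    exact h.eventually (gt_mem_nhds (half_pos hε))
  obtain ⟨F, hF⟩ := HomeoPlusReal.exists_pointwiseStabilizer_subset hU
  -- Half of `ε` suffices: once `v` is invariant, `‖π(g)ξ - ξ‖ ≤ 2‖v - ξ‖`.
  obtain ⟨v, hvξ, hv⟩ := π.exists_fixed_of_dist_le _ ξ (ε / 2) fun g hg => (hF hg).le
  have hgv := π.toHom_apply_eq_of_fixed_by_pointwiseStabilizer F v hv g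
  have h1 : dist ((π.toHom g : H →L[ℂ] H) ξ) v = dist v ξ := by
    conv_lhs => rw [← hgv]
    rw [dist_eq_norm, ← map_sub, UnitaryRep.norm_toHom, ← dist_eq_norm, dist_comm]
  have h2 := dist_triangle ((π.toHom g : H →L[ℂ] H) ξ) v ξ
  rw [h1, dist_eq_norm v] at h2
  linarith
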